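/- Let $\Omega\subset\mathbb R^3$ be a bounded domain (non-empty, open, connected) with Lipschitz boundary, and let $\Gamma=\{x\in\bar\Omega:\ x'=0\}$, where $x'=(x_1,x_2,0)$. Let $q>3$. Then there is a constant $c>0$ depending only on $\Omega$ and $q$ such that the following holds. Let $2<p<\infty$, $p'=\frac p{p-1}$, $\alpha\in\mathbb R$, let $b\in L_{p'}(\Omega;\mathbb R^3)$ satisfy $\operatorname{div} b=0$ in the sense of distributions on $\Omega$, put $b_0(x)=b(x)+\alpha\,\frac{x'}{|x'|^2}$, and let $f\in L_q(\Omega;\mathbb R^3)$. Let $u$ be a $p$-weak solution of $$-\Delta u+b_0\cdot\nabla u=-\operatorname{div} f\ \text{ in }\Omega,\qquad u|_{\partial\Omega}=0,$$ that is, $u$ belongs to the closure $\overset{\circ}{W}{}^1_p(\Omega)$ of $C_0^\infty(\Omega)$ in the Sobolev space $W^1_p(\Omega)$ and $$\int_\Omega \nabla u\cdot\nabla\eta\,dx+\int_\Omega \eta\, b_0\cdot\nabla u\,dx=\int_\Omega f\cdot\nabla\eta\,dx\qquad\text{for all }\eta\in C_0^\infty(\Omega).$$ Assume that $u|_\Gamma=0$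 in the sense of traces; here the trace on $\Gamma$ is the continuous extension to $\overset{\circ}{W}{}^1_p(\Omega)$, with values in $L_p(\Gamma)$, of the restriction $\varphi\mapsto\varphi|_\Gamma$, $\varphi\in C_0^\infty(\Omega)$ (it exists since $p>2$). Then $u$ is essentially bounded and $$\|u\|_{L_\infty(\Omega)}\le c\,\|f\|_{L_q(\Omega)}.$$ -/

import Mathlib

open MeasureTheory Filter Topology TopologicalSpace
open scoped ENNReal NNReal Distributions

noncomputable section

namespace SingularDrift

/-- Three-dimensional Euclidean space. -/
abbrev E3 : Type := EuclideanSpace ℝ (Fin 3)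

/-- `Ω` has a Lipschitz boundary: near every boundary point, after a rotation or reflection of the
coordinates, `Ω` is the region strictly above the graph of a Lipschitz function of two variables. -/
def HasLipschitzBoundary (Ω : Set E3) : Prop :=
  ∀ x₀ ∈ frontier Ω, ∃ (e : E3 ≃ₗᵢ[ℝ] E3) (r : ℝ) (K : ℝ≥0) (γ : EuclideanSpace ℝ (Fin 2) → ℝ),
    0 < r ∧ LipschitzWith K γ ∧
      ∀ x ∈ Metric.ball x₀ r, x ∈ Ω ↔ γ (!₂[e x 0, e x 1]) < e x 2

/-- `g` is the weak (distributional) gradient of `u` in `Ω`. Here `𝓓(Ω, ℝ)` is the space of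
smooth functions with compact support in `Ω`. -/
def HasWeakGradient (Ω : Opens E3) (u : E3 → ℝ) (g : E3 → E3) : Prop :=
  LocallyIntegrableOn u Ω ∧ LocallyIntegrableOn g Ω ∧
    ∀ φ : 𝓓(Ω, ℝ), ∫ x in (Ω : Set E3), u x • gradient φ x = - ∫ x in (Ω : Set E3), φ x • g x

/-- `u` belongs to the Sobolev space `W¹ₚ(Ω)` and `g` is its weak gradient. -/
def MemSobolev (Ω : Opens E3) (p : ℝ≥0∞) (u : E3 → ℝ) (g : E3 → E3) : Prop :=
  MemLp u p (volume.restrict Ω) ∧ MemLp g p (volume.restrict Ω) ∧ HasWeakGradient Ω u g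

/-- The test functions `φ n` converge in the norm of `W¹ₚ(Ω)` to the function `u` with weak
gradient `g`. -/
def TendstoInSobolev (Ω : Opens E3) (p : ℝ≥0∞) (φ : ℕ → 𝓓(Ω, ℝ)) (u : E3 → ℝ) (g : E3 → E3) :
    Prop :=
  Tendsto (fun n => eLpNorm (fun x => φ n x - u x) p (volume.restrict Ω)) atTop (𝓝 0) ∧
  Tendsto (fun n => eLpNorm (fun x => gradient (φ n) x - g x) p (volume.restrict Ω)) atTop (𝓝 0)

/-- `u` belongs to the closure of `C₀^∞(Ω)` in `W¹ₚ(Ω)` and `g` is its weak gradient. -/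
def MemSobolevZero (Ω : Opens E3) (p : ℝ≥0∞) (u : E3 → ℝ) (g : E3 → E3) : Prop :=
  MemSobolev Ω p u g ∧ ∃ φ : ℕ → 𝓓(Ω, ℝ), TendstoInSobolev Ω p φ u g

/-- The horizontal part `x' = (x₁, x₂, 0)` of `x = (x₁, x₂, x₃)`. -/
def horizontal (x : E3) : E3 := !₂[x 0, x 1, 0]

/-- The drift `b₀ = b + α x' / |x'|²`. -/
def drift (b : E3 → E3) (α : ℝ) (x : E3) : E3 :=
  b x + (α / ‖horizontal x‖ ^ 2) • horizontal x

/-- `div b = 0` in the sense of distributions on `Ω`. -/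
def DivergenceFree (Ω : Opens E3) (b : E3 → E3) : Prop :=
  ∀ φ : 𝓓(Ω, ℝ), ∫ x in (Ω : Set E3), inner ℝ (b x) (gradient φ x) = 0

/-- The part `Γ = {x ∈ closure Ω : x' = 0}` of the vertical axis. -/
def axis (Ω : Opens E3) : Set E3 := {x | x ∈ closure (Ω : Set E3) ∧ horizontal x = 0}

/-- The length measure on `Γ`: the image of Lebesgue measure under the arc length parametrization
`t ↦ (0, 0, t)` of the vertical axis, restricted to `Γ`. -/
def axisMeasure (Ω : Opens E3) : Measure E3 :=
  (Measure.map (fun t : ℝ => (!₂[0, 0, t] : E3)) volume).restrict (axis Ω)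

/-- The function `u` in the closure of `C₀^∞(Ω)` in `W¹ₚ(Ω)` has the trace `τ ∈ Lₚ(Γ)` on `Γ`: the
pair `(u, τ)` is a limit, in `W¹ₚ(Ω) × Lₚ(Γ)`, of pairs `(φ, φ|_Γ)` with `φ ∈ C₀^∞(Ω)`. For `p > 2`
the restriction `φ ↦ φ|_Γ` is continuous from the norm of `W¹ₚ(Ω)` to `Lₚ(Γ)`, so that this is the
value of its continuous extension at `u`, whatever approximating sequence is used. -/
def HasAxisTrace (Ω : Opens E3) (p : ℝ≥0∞) (u : E3 → ℝ) (τ : E3 → ℝ) : Prop :=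
  MemLp τ p (axisMeasure Ω) ∧
  ∃ g : E3 → E3, MemSobolev Ω p u g ∧ ∃ φ : ℕ → 𝓓(Ω, ℝ), TendstoInSobolev Ω p φ u g ∧
    Tendsto (fun n => eLpNorm (fun x => φ n x - τ x) p (axisMeasure Ω)) atTop (𝓝 0)

/-- `u` is a `p`-weak solution of `-Δu + b₀ · ∇u = -div f` in `Ω`, `u = 0` on `∂Ω`: it lies in the
closure of `C₀^∞(Ω)` in `W¹ₚ(Ω)` and
`∫ ∇u · ∇η + ∫ η b₀ · ∇u = ∫ f · ∇η` for all `η ∈ C₀^∞(Ω)`. -/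
def IsWeakSolution (Ω : Opens E3) (p : ℝ≥0∞) (b₀ f : E3 → E3) (u : E3 → ℝ) : Prop :=
  ∃ g : E3 → E3, MemSobolevZero Ω p u g ∧
    ∀ η : 𝓓(Ω, ℝ),
      (∫ x in (Ω : Set E3), inner ℝ (g x) (gradient η x)) +
          (∫ x in (Ω : Set E3), η x * inner ℝ (b₀ x) (g x)) =
        ∫ x in (Ω : Set E3), inner ℝ (f x) (gradient η x)

end SingularDrift

end

open SingularDrift

/-!
The solution is tested with a truncation `T(u)` that vanishes where `|u| ≤ k` and is nearly constant
where `|u| ≥ h`. With `H' = T`, the drift term `∫ T(u) b₀ · ∇u` is `∫ b₀ · ∇H(u)`. The divergence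
of `b` vanishes and that of `x' / |x'|²` is `2π` times the length measure of the axis
(`integral_inner_lineSource_gradient`, by polar coordinates in horizontal planes), so the term is
`-2πα ∫_Γ H(u)`, which vanishes because the trace of `u` does. What remains is the energy identity
`∫ T'(u) |∇u|² = ∫ T'(u) f · ∇u` of the equation without drift (`energy_identity`), with no
dependence on `p`, `b` and `α`.

The truncations are smooth (`exists_smoothTruncation`), so that `T(φ)` and `H(φ)` are test functions
for every test function `φ`. The identity is derived along test functions `φ n → u` whose traces
tend to zero, and neither the chain rule for Sobolev functions nor the trace operator is needed. The
limits are taken with `tendsto_integral_comp_mul_inner`, since `x' / |x'|²` is in `Lₛ` for `s < 2`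
and hence in `L_{p'}` (`memLp_lineSource`).

The energy identity, the Sobolev embedding into `L₆`, Hölder's and Chebyshev's inequalities give
`|{|u| > h}| ≤ (C ‖f‖_q / (h - k))⁶ |{|u| > k}| ^ (3 - 6 / q)` (`measureReal_superlevel_le`). The
exponent exceeds one exactly when `q > 3`, and then Stampacchia's iteration
(`stampacchia_iteration`) shows that the superlevel sets are null from the level `c ‖f‖_q` on, where
`c` depends only on `q` and the volume of `Ω`.
-/

/-! ### Smooth truncations -/

/-- The derivative of the smooth transition function is nonnegative and bounded. -/
theorem exists_deriv_smoothTransition_bound :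
    ∃ L : ℝ, 1 ≤ L ∧ ∀ x, 0 ≤ deriv Real.smoothTransition x ∧
      deriv Real.smoothTransition x ≤ L := by
  have hsupp : HasCompactSupport (deriv Real.smoothTransition) := by
    refine HasCompactSupport.intro (isCompact_Icc (a := (0 : ℝ)) (b := 1)) fun x hx => ?_
    rcases lt_or_ge x 0 with h | h
    · have : Real.smoothTransition =ᶠ[𝓝 x] fun _ => 0 := by
        filter_upwards [Iio_mem_nhds h] with y hy
        exact Real.smoothTransition.zero_of_nonpos (le_of_lt hy)
      simp [this.deriv_eq]
    · have h1 : 1 < x := by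
        by_contra hc
        exact hx ⟨h, not_lt.1 hc⟩
      have : Real.smoothTransition =ᶠ[𝓝 x] fun _ => 1 := by
        filter_upwards [Ioi_mem_nhds h1] with y hy
        exact Real.smoothTransition.one_of_one_le (le_of_lt hy)
      simp [this.deriv_eq]
  have hcont : Continuous (deriv Real.smoothTransition) :=
    (Real.smoothTransition.contDiff (n := 1)).continuous_deriv le_rfl
  obtain ⟨C, hC⟩ := hcont.bounded_above_of_compact_support hsupp
  refine ⟨max C 1, le_max_right _ _, fun x => ⟨Real.smoothTransition.monotone.deriv_nonneg, ?_⟩⟩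
  exact ((le_abs_self _).trans (hC x)).trans (le_max_left _ _)

/-- A smooth truncation `T` between the levels `k < h`: it vanishes on `[-k, k]`, its derivative
`T'` takes values in `[0, 1]`, and `|T|` is at least `κ * (h - k)` outside `(-h, h)`. A smooth
primitive `H` of `T` is part of the data. -/
structure SmoothTruncation (κ k h : ℝ) where
  /-- The primitive of the truncation. -/
  H : ℝ → ℝ
  /-- The truncation. -/
  T : ℝ → ℝ
  /-- The derivative of the truncation. -/
  T' : ℝ → ℝ
  contDiff_H : ContDiff ℝ (⊤ : ℕ∞) H
  contDiff_T : ContDiff ℝ (⊤ : ℕ∞) T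
  continuous_T' : Continuous T'
  hasDerivAt_H : ∀ s, HasDerivAt H (T s) s
  hasDerivAt_T : ∀ s, HasDerivAt T (T' s) s
  H_zero : H 0 = 0
  T_zero : T 0 = 0
  T'_nonneg : ∀ s, 0 ≤ T' s
  T'_le_one : ∀ s, T' s ≤ 1
  T'_eq_zero : ∀ s, |s| ≤ k → T' s = 0
  abs_T_le : ∀ s, |T s| ≤ h - k
  le_abs_T : ∀ s, h ≤ |s| → κ * (h - k) ≤ |T s|
  abs_H_le : ∀ s, |H s| ≤ (h - k) * |s|

/-- Smooth truncations exist for all levels, with a universal constant `κ`. They are rescaled odd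
extensions of the smooth transition function. -/
theorem exists_smoothTruncation :
    ∃ κ : ℝ, 0 < κ ∧ ∀ k h : ℝ, 0 ≤ k → k < h → Nonempty (SmoothTruncation κ k h) := by
  obtain ⟨L, hL1, hL⟩ := exists_deriv_smoothTransition_bound
  have hL0 : 0 < L := by linarith
  refine ⟨L⁻¹, by positivity, fun k h hk hkh => ?_⟩
  set θ := Real.smoothTransition with hθ
  have hd : 0 < h - k := by linarith
  set d := h - k with hd_def
  have hθs : ContDiff ℝ (⊤ : ℕ∞) θ := Real.smoothTransition.contDiff
  have hθd : ∀ x, HasDerivAt θ (deriv θ x) x := fun x =>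
    (hθs.differentiable (by simp) x).hasDerivAt
  have hθc : Continuous (deriv θ) := hθs.continuous_deriv (by simp)
  -- one of the two arguments of `θ` is always nonpositive, since `k ≥ 0`
  have hneg : ∀ s, s ≤ k → (s - k) / d ≤ 0 := fun s hs =>
    div_nonpos_of_nonpos_of_nonneg (by linarith) hd.le
  have hder0 : ∀ x, x ≤ 0 → deriv θ x = 0 := by
    have h1 : ∀ x, x < 0 → deriv θ x = 0 := fun x hx => by
      have : θ =ᶠ[𝓝 x] fun _ => 0 := by
        filter_upwards [Iio_mem_nhds hx] with y hy
        exact Real.smoothTransition.zero_of_nonpos (le_of_lt hy)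
      simp [this.deriv_eq]
    intro x hx
    have : Set.Iic (0 : ℝ) ⊆ {x | deriv θ x = 0} := by
      rw [← closure_Iio (0 : ℝ)]
      exact (isClosed_eq hθc continuous_const).closure_subset_iff.2 h1
    exact this hx
  set T : ℝ → ℝ := fun s => d / L * (θ ((s - k) / d) - θ ((-s - k) / d)) with hT
  have hTs : ContDiff ℝ (⊤ : ℕ∞) T := by
    refine contDiff_const.mul ((hθs.comp ?_).sub (hθs.comp ?_)) <;> fun_prop
  have hTb : ∀ s, |T s| ≤ d := by
    intro s
    have h1 := Real.smoothTransition.nonneg ((s - k) / d)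
    have h2 := Real.smoothTransition.nonneg ((-s - k) / d)
    have h3 := Real.smoothTransition.le_one ((s - k) / d)
    have h4 := Real.smoothTransition.le_one ((-s - k) / d)
    have h5 : |θ ((s - k) / d) - θ ((-s - k) / d)| ≤ 1 := by
      rw [abs_le]; constructor <;> linarith
    rw [hT]; simp only [abs_mul, abs_of_pos (div_pos hd hL0)]
    calc d / L * |θ ((s - k) / d) - θ ((-s - k) / d)| ≤ d / L * 1 := by gcongr
      _ ≤ d := by rw [mul_one]; exact div_le_self hd.le hL1
  have hHd : ∀ s, HasDerivAt (fun s => ∫ t in (0 : ℝ)..s, T t) (T s) s := fun s =>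
    intervalIntegral.integral_hasDerivAt_right (hTs.continuous.intervalIntegrable _ _)
      hTs.continuous.stronglyMeasurable.stronglyMeasurableAtFilter hTs.continuous.continuousAt
  refine ⟨{
    H := fun s => ∫ t in (0 : ℝ)..s, T t
    T := T
    T' := fun s => L⁻¹ * (deriv θ ((s - k) / d) + deriv θ ((-s - k) / d))
    contDiff_H := ?_
    contDiff_T := hTs
    continuous_T' := ?_
    hasDerivAt_H := hHd
    hasDerivAt_T := ?_
    H_zero := by simp
    T_zero := by simp [hT]
    T'_nonneg := ?_
    T'_le_one := ?_
    T'_eq_zero := ?_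
    abs_T_le := hTb
    le_abs_T := ?_
    abs_H_le := ?_ }⟩
  · rw [contDiff_infty_iff_deriv]
    refine ⟨fun s => (hHd s).differentiableAt, ?_⟩
    have : deriv (fun s => ∫ t in (0 : ℝ)..s, T t) = T := funext fun s => (hHd s).deriv
    rw [this]; exact hTs
  · fun_prop
  · intro s
    have h1 : HasDerivAt (fun s : ℝ => (s - k) / d) (1 / d) s :=
      ((hasDerivAt_id s).sub_const k).div_const d
    have h2 : HasDerivAt (fun s : ℝ => (-s - k) / d) (-1 / d) s :=
      ((hasDerivAt_id s).neg.sub_const k).div_const d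
    have := (((hθd _).comp s h1).sub ((hθd _).comp s h2)).const_mul (d / L)
    exact this.congr_deriv (by field_simp; ring)
  · intro s
    exact mul_nonneg (by positivity) (add_nonneg (hL _).1 (hL _).1)
  · intro s
    have : deriv θ ((s - k) / d) + deriv θ ((-s - k) / d) ≤ L := by
      rcases le_total s 0 with hs | hs
      · rw [hder0 _ (hneg s (by linarith)), zero_add]; exact (hL _).2
      · rw [hder0 _ (hneg (-s) (by linarith)), add_zero]; exact (hL _).2
    calc L⁻¹ * (deriv θ ((s - k) / d) + deriv θ ((-s - k) / d)) ≤ L⁻¹ * L := by gcongr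
      _ = 1 := inv_mul_cancel₀ hL0.ne'
  · intro s hs
    have hs' := abs_le.1 hs
    rw [hder0 _ (hneg s hs'.2), hder0 _ (hneg (-s) (by linarith)), add_zero, mul_zero]
  · intro s hs
    have h1 : ∀ t, h ≤ t → θ ((t - k) / d) = 1 := fun t ht =>
      Real.smoothTransition.one_of_one_le (by rw [le_div_iff₀ hd]; linarith)
    have h0 : ∀ t, t ≤ 0 → θ ((t - k) / d) = 0 := fun t ht =>
      Real.smoothTransition.zero_of_nonpos (hneg t (by linarith))
    rcases le_total 0 s with h | h
    · rw [abs_of_nonneg h] at hs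
      simp only [hT]
      rw [h1 s hs, h0 (-s) (by linarith), sub_zero, mul_one, abs_of_pos (div_pos hd hL0),
        inv_mul_eq_div]
    · rw [abs_of_nonpos h] at hs
      simp only [hT]
      rw [h1 (-s) hs, h0 s h, zero_sub, mul_neg_one, abs_neg, abs_of_pos (div_pos hd hL0),
        inv_mul_eq_div]
  · intro s
    have := intervalIntegral.norm_integral_le_of_norm_le_const (a := 0) (b := s) (f := T) (C := d)
      (fun x _ => hTb x)
    simpa using this

/-! ### Iteration over the levels -/

/-- **Stampacchia's lemma**: a nonincreasing function `Φ` on the half line satisfying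
`Φ h ≤ (C / (h - k)) ^ 6 * Φ k ^ β` for some `β > 1` vanishes from an explicit point on. -/
theorem stampacchia_iteration {Φ : ℝ → ℝ} {C β d : ℝ} (hβ : 1 < β) (hd : 0 < d)
    (hΦ0 : ∀ k, 0 ≤ k → 0 ≤ Φ k) (hanti : ∀ k h, 0 ≤ k → k ≤ h → Φ h ≤ Φ k)
    (hdec : ∀ k h, 0 ≤ k → k < h → Φ h ≤ (C / (h - k)) ^ 6 * Φ k ^ β)
    (hdC : (C / d) ^ 6 * Φ 0 ^ (β - 1) * (2 : ℝ) ^ (6 * β / (β - 1)) ≤ 1) :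
    Φ d = 0 := by
  have hβ1 : 0 < β - 1 := by linarith
  set μ : ℝ := 6 / (β - 1) with hμ
  have hμ0 : 0 < μ := by positivity
  -- the levels increase from `0` to `d`, and `Φ` decays geometrically along them
  set κ : ℕ → ℝ := fun n => d * (1 - (1 / 2) ^ n) with hκ
  have hκ0 : ∀ n, 0 ≤ κ n := fun n =>
    mul_nonneg hd.le (sub_nonneg.2 (pow_le_one₀ (by norm_num) (by norm_num)))
  have hκd : ∀ n, κ n ≤ d := fun n => by
    have : (0 : ℝ) ≤ (1 / 2) ^ n := by positivity
    simp only [hκ]; nlinarith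
  have hκs : ∀ n, κ (n + 1) - κ n = d * (1 / 2) ^ (n + 1) := fun n => by
    simp only [hκ, pow_succ]; ring
  have hΦ00 := hΦ0 0 le_rfl
  have key : ∀ n : ℕ, Φ (κ n) ≤ Φ 0 * (2 : ℝ) ^ (-(n * μ)) := by
    intro n
    induction n with
    | zero => simp [hκ]
    | succ n ih =>
      have hpos : 0 < κ (n + 1) - κ n := by rw [hκs]; positivity
      have h1 := hdec (κ n) (κ (n + 1)) (hκ0 n) (by linarith)
      have h2 : Φ (κ n) ^ β ≤ (Φ 0 * (2 : ℝ) ^ (-(n * μ))) ^ β :=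
        Real.rpow_le_rpow (hΦ0 _ (hκ0 n)) ih (by linarith)
      have h3 : (C / (κ (n + 1) - κ n)) ^ 6 = (C / d) ^ 6 * (2 : ℝ) ^ (6 * (n + 1) : ℝ) := by
        rw [hκs]
        have : C / (d * (1 / 2) ^ (n + 1)) = C / d * 2 ^ (n + 1) := by
          rw [one_div, inv_pow]; field_simp
        rw [this, mul_pow, ← pow_mul]
        congr 1
        rw [← Real.rpow_natCast]
        congr 1
        push_cast; ring
      have h4 : (Φ 0 * (2 : ℝ) ^ (-(n * μ))) ^ β =
          Φ 0 * Φ 0 ^ (β - 1) * (2 : ℝ) ^ (-(n * μ) * β) := by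
        rw [Real.mul_rpow hΦ00 (by positivity), ← Real.rpow_mul (by norm_num)]
        congr 1
        rcases hΦ00.eq_or_lt with h | h
        · rw [← h, Real.zero_rpow (by linarith), zero_mul]
        · rw [← Real.rpow_one_add' hΦ00 (by linarith)]
          congr 1; ring
      have h5 : (2 : ℝ) ^ (6 * (n + 1) : ℝ) * (2 : ℝ) ^ (-(n * μ) * β)
          = (2 : ℝ) ^ (6 * β / (β - 1)) * (2 : ℝ) ^ (-((n + 1 : ℕ) * μ)) := by
        rw [← Real.rpow_add two_pos, ← Real.rpow_add two_pos]
        congr 1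
        rw [hμ]; push_cast; field_simp; ring
      calc Φ (κ (n + 1)) ≤ (C / (κ (n + 1) - κ n)) ^ 6 * Φ (κ n) ^ β := h1
        _ ≤ (C / (κ (n + 1) - κ n)) ^ 6 * (Φ 0 * (2 : ℝ) ^ (-(n * μ))) ^ β := by gcongr
        _ = ((C / d) ^ 6 * Φ 0 ^ (β - 1)) * Φ 0 *
            ((2 : ℝ) ^ (6 * (n + 1) : ℝ) * (2 : ℝ) ^ (-(n * μ) * β)) := by rw [h3, h4]; ring
        _ = ((C / d) ^ 6 * Φ 0 ^ (β - 1) * (2 : ℝ) ^ (6 * β / (β - 1))) *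
            (Φ 0 * (2 : ℝ) ^ (-((n + 1 : ℕ) * μ))) := by rw [h5]; ring
        _ ≤ 1 * (Φ 0 * (2 : ℝ) ^ (-((n + 1 : ℕ) * μ))) := by gcongr
        _ = _ := one_mul _
  have hlim : Tendsto (fun n : ℕ => Φ 0 * (2 : ℝ) ^ (-(n * μ))) atTop (𝓝 0) := by
    have : ∀ n : ℕ, (2 : ℝ) ^ (-(n * μ)) = ((2 : ℝ) ^ (-μ)) ^ n := fun n => by
      rw [← Real.rpow_natCast, ← Real.rpow_mul (by norm_num)]; congr 1; ring
    simp_rw [this]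
    have h := tendsto_pow_atTop_nhds_zero_of_lt_one (r := (2 : ℝ) ^ (-μ)) (by positivity)
      (Real.rpow_lt_one_of_one_lt_of_neg (by norm_num) (by linarith))
    simpa using h.const_mul (Φ 0)
  refine le_antisymm (ge_of_tendsto' hlim fun n => ?_) (hΦ0 d hd.le)
  exact (hanti _ _ (hκ0 n) (hκd n)).trans (key n)

/-! ### The field of a line source -/

/-- The field `x' / |x'|²` of a line source on the vertical axis, extended by zero to the axis. -/
noncomputable def lineSource (x : E3) : E3 := (1 / ‖horizontal x‖ ^ 2) • horizontal x

theorem norm_horizontal_sq (x : E3) : ‖horizontal x‖ ^ 2 = x 0 ^ 2 + x 1 ^ 2 := by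
  simp [EuclideanSpace.norm_sq_eq, horizontal, Fin.sum_univ_three]

theorem continuous_horizontal : Continuous horizontal := by
  unfold horizontal
  refine (PiLp.continuous_toLp 2 _).comp (continuous_pi fun i => ?_)
  fin_cases i <;> simp <;> fun_prop

theorem measurable_lineSource : Measurable lineSource := by
  unfold lineSource
  have := continuous_horizontal.measurable
  fun_prop

theorem norm_lineSource (x : E3) : ‖lineSource x‖ = ‖horizontal x‖⁻¹ := by
  rw [lineSource, norm_smul]
  rcases eq_or_ne ‖horizontal x‖ 0 with h | h
  · simp [h]
  · rw [Real.norm_of_nonneg (by positivity)]; field_simp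

/-- The point with horizontal coordinates `w.2` at height `w.1`. -/
noncomputable def ofCylinder (w : ℝ × ℝ × ℝ) : E3 := !₂[w.2.1, w.2.2, w.1]

/-- Cylindrical splitting of space as a measurable equivalence. -/
noncomputable def cylinderEquiv : ℝ × ℝ × ℝ ≃ᵐ E3 :=
  ((MeasurableEquiv.prodCongr (MeasurableEquiv.refl ℝ) MeasurableEquiv.finTwoArrow.symm).trans
    (MeasurableEquiv.piFinSuccAbove (fun _ : Fin 3 => ℝ) 2).symm).trans (MeasurableEquiv.toLp 2 _)

theorem coe_cylinderEquiv : ⇑cylinderEquiv = ofCylinder := by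
  funext w
  ext i
  fin_cases i <;> rfl

theorem measurePreserving_ofCylinder : MeasurePreserving ofCylinder := by
  have h1 : MeasurePreserving (MeasurableEquiv.prodCongr (MeasurableEquiv.refl ℝ)
      (MeasurableEquiv.finTwoArrow (α := ℝ)).symm) volume volume :=
    (MeasurePreserving.id volume).prod ((volume_preserving_finTwoArrow ℝ).symm _)
  have h2 := (volume_preserving_piFinSuccAbove (fun _ : Fin 3 => ℝ) 2).symm _
  have h3 := PiLp.volume_preserving_toLp (Fin 3)
  rw [← coe_cylinderEquiv]
  exact h3.comp (h2.comp h1)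

theorem measurableEmbedding_ofCylinder : MeasurableEmbedding ofCylinder :=
  coe_cylinderEquiv ▸ cylinderEquiv.measurableEmbedding

theorem norm_snd_le_norm_horizontal_ofCylinder (w : ℝ × ℝ × ℝ) :
    ‖w.2‖ ≤ ‖horizontal (ofCylinder w)‖ := by
  have h := norm_horizontal_sq (ofCylinder w)
  simp only [ofCylinder] at h
  simp at h
  refine max_le ?_ ?_ <;> refine abs_le_of_sq_le_sq ?_ (norm_nonneg _) <;> rw [ofCylinder, h] <;>
    nlinarith [sq_nonneg w.2.1, sq_nonneg w.2.2]

/-- Powers `|x'|⁻ˢ`, `s < 2`, are integrable on bounded cylinders. -/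
theorem integrable_cylinder_rpow {s : ℝ} (hs : s < 2) (R : ℝ) :
    Integrable (fun w : ℝ × ℝ × ℝ => (Set.Icc (-R) R).indicator (fun _ => (1 : ℝ)) w.1 *
      (Set.Iic R).indicator (fun r : ℝ => r ^ (-s)) ‖w.2‖) := by
  have h1 : Integrable ((Set.Icc (-R) R).indicator fun _ => (1 : ℝ)) volume :=
    (integrable_indicator_iff measurableSet_Icc).2 (integrableOn_const (by simp))
  have h2 : Integrable (fun v : ℝ × ℝ => (Set.Iic R).indicator (fun r : ℝ => r ^ (-s)) ‖v‖) := by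
    rw [integrable_fun_norm_addHaar (volume : Measure (ℝ × ℝ))
      (f := (Set.Iic R).indicator (fun r : ℝ => r ^ (-s)))]
    have h3 : IntegrableOn (fun r : ℝ => r ^ (1 - s)) (Set.Ioc 0 R) := by
      rcases le_total 0 R with hR | hR
      · exact (intervalIntegrable_iff_integrableOn_Ioc_of_le hR).1
          (intervalIntegral.intervalIntegrable_rpow' (by linarith))
      · simp [Set.Ioc_eq_empty_of_le hR]
    rw [← Set.Ioi_inter_Iic] at h3
    have h4 : IntegrableOn ((Set.Iic R).indicator fun r : ℝ => r ^ (1 - s)) (Set.Ioi 0) := by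
      rw [IntegrableOn, integrable_indicator_iff measurableSet_Iic, IntegrableOn,
        Measure.restrict_restrict measurableSet_Iic, Set.inter_comm]
      exact h3
    refine h4.congr_fun (fun r hr => ?_) measurableSet_Ioi
    by_cases hrR : r ∈ Set.Iic R
    · simp [Set.indicator_of_mem hrR, sub_eq_add_neg, Real.rpow_add (show 0 < r from hr)]
    · simp [Set.indicator_of_notMem hrR]
  exact h1.mul_prod h2

/-- The field `x' / |x'|²` is in `Lₛ` on bounded sets for all `s < 2`. -/
theorem memLp_lineSource {s : ℝ} (hs0 : 0 < s) (hs : s < 2) {Ω : Set E3}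
    (hΩ : Bornology.IsBounded Ω) :
    MemLp lineSource (ENNReal.ofReal s) (volume.restrict Ω) := by
  obtain ⟨R, hR⟩ := hΩ.subset_closedBall 0
  have hsub : MemLp lineSource (ENNReal.ofReal s) (volume.restrict (Metric.closedBall 0 R)) := by
    have hs0' : ENNReal.ofReal s ≠ 0 := by simpa using hs0
    rw [← integrable_norm_rpow_iff measurable_lineSource.aestronglyMeasurable hs0'
      ENNReal.ofReal_ne_top, ENNReal.toReal_ofReal hs0.le]
    change IntegrableOn _ _ _
    rw [← integrable_indicator_iff Metric.isClosed_closedBall.measurableSet,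
      ← measurePreserving_ofCylinder.integrable_comp_emb measurableEmbedding_ofCylinder]
    refine (integrable_cylinder_rpow hs R).mono' ?_ (ae_of_all _ fun w => ?_)
    · refine Measurable.aestronglyMeasurable ?_
      refine Measurable.comp ?_ measurePreserving_ofCylinder.measurable
      exact (measurable_lineSource.norm.pow_const s).indicator
        Metric.isClosed_closedBall.measurableSet
    · simp only [Function.comp]
      have hnn : 0 ≤ (Set.Icc (-R) R).indicator (fun _ => (1 : ℝ)) w.1 *
          (Set.Iic R).indicator (fun r : ℝ => r ^ (-s)) ‖w.2‖ := by
        refine mul_nonneg (Set.indicator_nonneg (fun _ _ => zero_le_one) _) ?_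
        rw [Set.indicator_apply]
        split_ifs <;> positivity
      by_cases hw : ofCylinder w ∈ Metric.closedBall 0 R
      · rw [mem_closedBall_zero_iff] at hw
        have hle : ‖horizontal (ofCylinder w)‖ ≤ R := by
          refine le_trans ?_ hw
          refine le_of_sq_le_sq ?_ (norm_nonneg _)
          rw [norm_horizontal_sq, EuclideanSpace.norm_sq_eq, Fin.sum_univ_three]
          simp only [Real.norm_eq_abs, sq_abs]
          nlinarith [sq_nonneg (ofCylinder w 2)]
        have h1 : w.1 ∈ Set.Icc (-R) R := by
          rw [Set.mem_Icc, ← abs_le]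
          have := (PiLp.norm_apply_le (ofCylinder w) 2).trans hw
          simpa [ofCylinder] using this
        have hn := norm_snd_le_norm_horizontal_ofCylinder w
        have h2 : ‖w.2‖ ∈ Set.Iic R := hn.trans hle
        rw [Set.indicator_of_mem h1, Set.indicator_of_mem h2, one_mul,
          Set.indicator_of_mem (by rwa [mem_closedBall_zero_iff]), norm_lineSource,
          Real.norm_of_nonneg (by positivity)]
        -- on the axis both sides are given by the conventions at zero
        rcases (norm_nonneg w.2).eq_or_lt with h0 | h0
        · have hw2 : w.2 = 0 := norm_eq_zero.1 h0.symm
          have : horizontal (ofCylinder w) = 0 := by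
            rw [← norm_eq_zero, ← sq_eq_zero_iff, norm_horizontal_sq]
            simp [ofCylinder, hw2]
          rw [this, norm_zero, inv_zero, Real.zero_rpow hs0.ne']
          positivity
        · rw [Real.inv_rpow (norm_nonneg _), ← Real.rpow_neg (norm_nonneg _)]
          exact Real.rpow_le_rpow_of_nonpos h0 hn (by linarith)
      · rw [Set.indicator_of_notMem hw, norm_zero]
        exact hnn
  exact hsub.mono_measure (Measure.restrict_mono hR le_rfl)

/-- In the plane, `div (w / |w|²)` is `2π` times the unit mass at the origin. -/
theorem integral_plane_source {ψ : ℝ × ℝ → ℝ} (hψ : ContDiff ℝ 1 ψ) (hc : HasCompactSupport ψ) :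
    ∫ w : ℝ × ℝ, (w.1 ^ 2 + w.2 ^ 2)⁻¹ * fderiv ℝ ψ w w = -(2 * Real.pi) * ψ 0 := by
  rw [← integral_comp_polarCoord_symm]
  set e : ℝ → ℝ × ℝ := fun t => (Real.cos t, Real.sin t) with he
  set D : ℝ × ℝ → ℝ := fun p => fderiv ℝ ψ (p.1 • e p.2) (e p.2) with hD
  have hfc : Continuous (fderiv ℝ ψ) := hψ.continuous_fderiv one_ne_zero
  have hec : Continuous e := by fun_prop
  have hDc : Continuous D := by
    refine (hfc.comp ?_).clm_apply ?_ <;> fun_prop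
  obtain ⟨R, hR⟩ := hc.isBounded.subset_closedBall 0
  -- `ℝ × ℝ` carries the sup norm, for which `e t` is not a unit vector; the factor `2` absorbs this
  have hball : ∀ r t, 2 * R < r → r • e t ∉ tsupport ψ := by
    intro r t hr hmem
    have h := hR hmem
    rw [mem_closedBall_zero_iff] at h
    have hR0 : 0 ≤ R := (norm_nonneg _).trans h
    have h1 := abs_le.1 ((norm_fst_le (r • e t)).trans h)
    have h2 := abs_le.1 ((norm_snd_le (r • e t)).trans h)
    simp only [he, Prod.smul_mk, smul_eq_mul] at h1 h2
    have h3 := sq_le_sq' h1.1 h1.2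
    have h4 := sq_le_sq' h2.1 h2.2
    have h5 : (r * Real.cos t) ^ 2 + (r * Real.sin t) ^ 2 = r ^ 2 := by
      rw [mul_pow, mul_pow, ← mul_add, Real.cos_sq_add_sin_sq, mul_one]
    nlinarith
  have hDz : ∀ p : ℝ × ℝ, 2 * R < p.1 → D p = 0 := fun p hp => by
    have : fderiv ℝ ψ (p.1 • e p.2) = 0 := by
      by_contra h
      exact hball _ _ hp (support_fderiv_subset ℝ h)
    simp [hD, this]
  have hcongr : ∫ p in polarCoord.target, p.1 •
      ((polarCoord.symm p).1 ^ 2 + (polarCoord.symm p).2 ^ 2)⁻¹ * fderiv ℝ ψ (polarCoord.symm p)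
        (polarCoord.symm p) = ∫ p in polarCoord.target, D p := by
    refine setIntegral_congr_fun polarCoord.open_target.measurableSet fun p hp => ?_
    have hp0 : 0 < p.1 := hp.1
    have hpe : polarCoord.symm p = p.1 • e p.2 := by simp [polarCoord, he]
    have hsq : (p.1 • e p.2).1 ^ 2 + (p.1 • e p.2).2 ^ 2 = p.1 ^ 2 := by
      simp only [he, Prod.smul_mk, smul_eq_mul]
      nlinarith [Real.sin_sq_add_cos_sq p.2]
    simp only [hpe, hsq, hD, map_smul, smul_eq_mul]
    field_simp
  have hint : IntegrableOn D (Set.Ioi 0 ×ˢ Set.Ioo (-Real.pi) Real.pi) := by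
    have hcpt : IntegrableOn D (Set.Icc 0 (2 * R) ×ˢ Set.Icc (-Real.pi) Real.pi) :=
      hDc.continuousOn.integrableOn_compact (isCompact_Icc.prod isCompact_Icc)
    refine IntegrableOn.of_forall_sdiff_eq_zero hcpt
      (measurableSet_Ioi.prod measurableSet_Ioo) fun p hp => ?_
    refine hDz p ?_
    by_contra hle
    exact hp.2 ⟨⟨le_of_lt hp.1.1, not_lt.1 hle⟩, Set.Ioo_subset_Icc_self hp.1.2⟩
  -- the integrand in polar coordinates is the radial derivative of `ψ`
  have hrad : ∀ t, ∫ r in Set.Ioi (0 : ℝ), D (r, t) = - ψ 0 := by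
    intro t
    have hder : ∀ r ∈ Set.Ici (0 : ℝ), HasDerivAt (fun r : ℝ => ψ (r • e t)) (D (r, t)) r := by
      intro r _
      have h1 : HasDerivAt (fun r : ℝ => r • e t) (e t) r := by
        simpa using (hasDerivAt_id r).smul_const (e t)
      exact ((hψ.differentiable one_ne_zero _).hasFDerivAt).comp_hasDerivAt r h1
    have hi : IntegrableOn (fun r => D (r, t)) (Set.Ioi 0) := by
      have hcpt : IntegrableOn (fun r => D (r, t)) (Set.Icc 0 (2 * R)) :=
        (hDc.comp (by fun_prop : Continuous fun r : ℝ => (r, t))).continuousOn.integrableOn_compact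
          isCompact_Icc
      refine IntegrableOn.of_forall_sdiff_eq_zero hcpt measurableSet_Ioi fun r hr => ?_
      refine hDz _ ?_
      by_contra hle
      exact hr.2 ⟨le_of_lt hr.1, not_lt.1 hle⟩
    have hlim : Tendsto (fun r : ℝ => ψ (r • e t)) atTop (𝓝 0) := by
      refine tendsto_const_nhds.congr' ?_
      filter_upwards [eventually_gt_atTop (2 * R)] with r hr
      exact (image_eq_zero_of_notMem_tsupport (hball r t hr)).symm
    have := integral_Ioi_of_hasDerivAt_of_tendsto' hder hi hlim
    simpa using this
  calc _ = ∫ p in polarCoord.target, D p := by rw [← hcongr]; simp only [smul_eq_mul, mul_assoc]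
    _ = ∫ p, D p ∂((volume.restrict (Set.Ioi 0)).prod
        (volume.restrict (Set.Ioo (-Real.pi) Real.pi))) := by
      rw [Measure.prod_restrict]; rfl
    _ = ∫ t in Set.Ioo (-Real.pi) Real.pi, ∫ r in Set.Ioi (0 : ℝ), D (r, t) := by
      refine integral_prod_symm _ ?_
      rw [Measure.prod_restrict]; exact hint
    _ = _ := by
      simp only [hrad, integral_const, smul_eq_mul, Measure.restrict_apply_univ, measureReal_def,
        Real.volume_Ioo]
      rw [ENNReal.toReal_ofReal (by linarith [Real.pi_pos])]
      ring

/-- The embedding of the horizontal plane into space. -/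
noncomputable def horizontalInclusion : ℝ × ℝ →L[ℝ] E3 :=
  (ContinuousLinearMap.fst ℝ ℝ ℝ).smulRight (EuclideanSpace.single 0 1) +
    (ContinuousLinearMap.snd ℝ ℝ ℝ).smulRight (EuclideanSpace.single 1 1)

theorem ofCylinder_eq (z : ℝ) (v : ℝ × ℝ) :
    ofCylinder (z, v) = horizontalInclusion v + !₂[0, 0, z] := by
  ext i
  fin_cases i <;> simp [ofCylinder, horizontalInclusion]

theorem horizontal_ofCylinder (z : ℝ) (v : ℝ × ℝ) :
    horizontal (ofCylinder (z, v)) = horizontalInclusion v := by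
  ext i
  fin_cases i <;> simp [ofCylinder, horizontalInclusion, horizontal]

theorem inner_gradient {φ : E3 → ℝ} (x v : E3) : inner ℝ v (gradient φ x) = fderiv ℝ φ x v := by
  rw [real_inner_comm, gradient, InnerProductSpace.toDual_symm_apply]

theorem inner_lineSource_gradient_ofCylinder {φ : E3 → ℝ} (hφ : ContDiff ℝ 1 φ) (z : ℝ)
    (v : ℝ × ℝ) :
    inner ℝ (lineSource (ofCylinder (z, v))) (gradient φ (ofCylinder (z, v))) =
      (v.1 ^ 2 + v.2 ^ 2)⁻¹ * fderiv ℝ (fun v => φ (ofCylinder (z, v))) v v := by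
  have hd : HasFDerivAt (fun v => ofCylinder (z, v)) horizontalInclusion v := by
    simp_rw [ofCylinder_eq]
    exact horizontalInclusion.hasFDerivAt.add_const _
  have hcomp : HasFDerivAt (fun v => φ (ofCylinder (z, v))) _ v :=
    (hφ.differentiable one_ne_zero (ofCylinder (z, v))).hasFDerivAt.comp v hd
  rw [inner_gradient, hcomp.fderiv, lineSource, map_smul, norm_horizontal_sq,
    horizontal_ofCylinder]
  simp [ofCylinder]

theorem continuous_gradient {φ : E3 → ℝ} (hφ : ContDiff ℝ 1 φ) : Continuous (gradient φ) :=
  (InnerProductSpace.toDual ℝ E3).symm.continuous.comp (hφ.continuous_fderiv one_ne_zero)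

theorem gradient_eq_zero_of_notMem_tsupport {φ : E3 → ℝ} {x : E3} (hx : x ∉ tsupport φ) :
    gradient φ x = 0 := by
  have : fderiv ℝ φ x = 0 := by
    by_contra h
    exact hx (support_fderiv_subset ℝ h)
  simp [gradient, this]

theorem exists_norm_gradient_le {φ : E3 → ℝ} (hφ : ContDiff ℝ 1 φ) (hc : HasCompactSupport φ) :
    ∃ C, ∀ x, ‖gradient φ x‖ ≤ C :=
  (continuous_gradient hφ).bounded_above_of_compact_support
    (HasCompactSupport.intro hc fun _ hx => gradient_eq_zero_of_notMem_tsupport hx)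

theorem integrable_inner_lineSource_gradient {φ : E3 → ℝ} (hφ : ContDiff ℝ 1 φ)
    (hc : HasCompactSupport φ) :
    Integrable fun x => inner ℝ (lineSource x) (gradient φ x) := by
  obtain ⟨C, hC⟩ := exists_norm_gradient_le hφ hc
  have h1 : IntegrableOn lineSource (tsupport φ) := by
    have := memLp_lineSource one_pos one_lt_two hc.isBounded
    rwa [ENNReal.ofReal_one, memLp_one_iff_integrable] at this
  have h2 : IntegrableOn (fun x => inner ℝ (lineSource x) (gradient φ x)) (tsupport φ) := by
    refine (h1.norm.mul_const C).mono' ?_ (ae_of_all _ fun x => ?_)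
    · exact (measurable_lineSource.inner (continuous_gradient hφ).measurable).aestronglyMeasurable
    · exact (norm_inner_le_norm _ _).trans (by gcongr; exact hC x)
  rw [← integrableOn_univ]
  refine h2.of_forall_sdiff_eq_zero MeasurableSet.univ fun x hx => ?_
  rw [gradient_eq_zero_of_notMem_tsupport hx.2, inner_zero_right]

/-- The distributional divergence of `x' / |x'|²` is `2π` times the length measure of the vertical
axis. -/
theorem integral_inner_lineSource_gradient {φ : E3 → ℝ} (hφ : ContDiff ℝ 1 φ)
    (hc : HasCompactSupport φ) :
    ∫ x, inner ℝ (lineSource x) (gradient φ x) = -(2 * Real.pi) * ∫ z : ℝ, φ !₂[0, 0, z] := by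
  have hint := (measurePreserving_ofCylinder.integrable_comp_emb
    measurableEmbedding_ofCylinder).2 (integrable_inner_lineSource_gradient hφ hc)
  rw [← measurePreserving_ofCylinder.integral_comp measurableEmbedding_ofCylinder]
  have hprod := integral_prod _ hint
  simp only [Function.comp] at hprod
  refine hprod.trans ?_
  rw [← integral_const_mul]
  congr 1
  funext z
  simp_rw [inner_lineSource_gradient_ofCylinder hφ]
  have hemb : (fun v => ofCylinder (z, v)) = fun v => horizontalInclusion v + !₂[0, 0, z] :=
    funext (ofCylinder_eq z)
  have hψ : ContDiff ℝ 1 fun v => φ (ofCylinder (z, v)) := by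
    refine hφ.comp (?_ : ContDiff ℝ 1 fun v => ofCylinder (z, v))
    rw [hemb]
    exact horizontalInclusion.contDiff.add contDiff_const
  have hcψ : HasCompactSupport fun v => φ (ofCylinder (z, v)) := by
    obtain ⟨R, hR⟩ := hc.isBounded.subset_closedBall 0
    refine HasCompactSupport.intro (isCompact_closedBall (0 : ℝ × ℝ) R) fun v hv => ?_
    refine image_eq_zero_of_notMem_tsupport fun hmem => hv ?_
    have h := hR hmem
    rw [mem_closedBall_zero_iff] at h ⊢
    have h0 : |v.1| ≤ ‖ofCylinder (z, v)‖ := PiLp.norm_apply_le (ofCylinder (z, v)) 0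
    have h1 : |v.2| ≤ ‖ofCylinder (z, v)‖ := PiLp.norm_apply_le (ofCylinder (z, v)) 1
    exact max_le (h0.trans h) (h1.trans h)
  rw [integral_plane_source hψ hcψ]
  rfl

/-! ### Limits of integrals of products -/

section Products

variable {X E : Type*} [MeasurableSpace X] {μ : Measure X} [NormedAddCommGroup E]
  [InnerProductSpace ℝ E] {P P' : ℝ≥0∞}

theorem eLpNorm_inner_le [P'.HolderConjugate P] {w G : X → E} (hw : MemLp w P' μ)
    (hG : MemLp G P μ) :
    eLpNorm (fun x => (inner ℝ (w x) (G x) : ℝ)) 1 μ ≤ eLpNorm w P' μ * eLpNorm G P μ := by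
  have := eLpNorm_le_eLpNorm_mul_eLpNorm'_of_norm (p := P') (q := P) (r := 1) hw.1 hG.1
    (fun a b => (inner ℝ a b : ℝ)) 1
    (ae_of_all _ fun x => by simpa using norm_inner_le_norm (𝕜 := ℝ) (w x) (G x))
  simpa using this

theorem MeasureTheory.MemLp.integrable_inner_of_holderConjugate [P'.HolderConjugate P] {w G : X → E}
    (hw : MemLp w P' μ) (hG : MemLp G P μ) : Integrable (fun x => (inner ℝ (w x) (G x) : ℝ)) μ :=
  memLp_one_iff_integrable.1 ⟨hw.1.inner hG.1, (eLpNorm_inner_le hw hG).trans_lt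
    (ENNReal.mul_lt_top hw.2 hG.2)⟩

theorem integrable_comp_mul {ψ : ℝ → ℝ} (hψ : Continuous ψ) {M : ℝ} (hM : ∀ s, |ψ s| ≤ M)
    {v F : X → ℝ} (hv : AEStronglyMeasurable v μ) (hF : Integrable F μ) :
    Integrable (fun x => ψ (v x) * F x) μ :=
  hF.bdd_mul (hψ.comp_aestronglyMeasurable hv) (ae_of_all _ fun x => hM (v x))

/-- If `v n → v` almost everywhere, then `∫ ψ(v n) F → ∫ ψ(v) F` for `ψ` bounded and continuous. -/
theorem tendsto_integral_comp_mul {ψ : ℝ → ℝ} (hψ : Continuous ψ) {M : ℝ} (hM : ∀ s, |ψ s| ≤ M)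
    {v : ℕ → X → ℝ} {v' F : X → ℝ} (hv : ∀ n, AEStronglyMeasurable (v n) μ)
    (hae : ∀ᵐ x ∂μ, Tendsto (fun n => v n x) atTop (𝓝 (v' x))) (hF : Integrable F μ) :
    Tendsto (fun n => ∫ x, ψ (v n x) * F x ∂μ) atTop (𝓝 (∫ x, ψ (v' x) * F x ∂μ)) := by
  refine tendsto_integral_of_dominated_convergence (fun x => M * |F x|)
    (fun n => (integrable_comp_mul hψ hM (hv n) hF).1) (hF.abs.const_mul M)
    (fun n => ae_of_all _ fun x => ?_) ?_
  · rw [norm_mul]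
    exact mul_le_mul_of_nonneg_right (hM _) (abs_nonneg _)
  · filter_upwards [hae] with x hx
    exact ((hψ.tendsto _).comp hx).mul_const _

/-- Products of an almost everywhere convergent bounded factor, a fixed factor in `L_{p'}` and a
factor converging in `Lₚ` can be integrated in the limit. -/
theorem tendsto_integral_comp_mul_inner [P'.HolderConjugate P] {ψ : ℝ → ℝ} (hψ : Continuous ψ)
    {M : ℝ} (hM : ∀ s, |ψ s| ≤ M) {v : ℕ → X → ℝ} {v' : X → ℝ}
    (hv : ∀ n, AEStronglyMeasurable (v n) μ)
    (hae : ∀ᵐ x ∂μ, Tendsto (fun n => v n x) atTop (𝓝 (v' x)))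
    {w G' : X → E} {G : ℕ → X → E} (hw : MemLp w P' μ) (hG' : MemLp G' P μ)
    (hG : ∀ n, MemLp (G n) P μ)
    (hlim : Tendsto (fun n => eLpNorm (fun x => G n x - G' x) P μ) atTop (𝓝 0)) :
    Tendsto (fun n => ∫ x, ψ (v n x) * inner ℝ (w x) (G n x) ∂μ) atTop
      (𝓝 (∫ x, ψ (v' x) * inner ℝ (w x) (G' x) ∂μ)) := by
  have h1 := tendsto_integral_comp_mul hψ hM hv hae (hw.integrable_inner_of_holderConjugate hG')
  have hsub : ∀ n, MemLp (fun x => G n x - G' x) P μ := fun n => (hG n).sub hG'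
  have h2 : Tendsto (fun n => ∫ x, ψ (v n x) * inner ℝ (w x) (G n x - G' x) ∂μ) atTop (𝓝 0) := by
    have hb : Tendsto (fun n => M * (eLpNorm w P' μ *
        eLpNorm (fun x => G n x - G' x) P μ).toReal) atTop (𝓝 0) := by
      have := (ENNReal.Tendsto.const_mul hlim (Or.inr hw.2.ne) (a := eLpNorm w P' μ))
      rw [mul_zero] at this
      simpa using ((ENNReal.tendsto_toReal ENNReal.zero_ne_top).comp this).const_mul M
    refine squeeze_zero_norm (fun n => ?_) hb
    have hi := hw.integrable_inner_of_holderConjugate (hsub n)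
    calc ‖∫ x, ψ (v n x) * inner ℝ (w x) (G n x - G' x) ∂μ‖
        ≤ ∫ x, M * ‖(inner ℝ (w x) (G n x - G' x) : ℝ)‖ ∂μ := by
          refine norm_integral_le_of_norm_le (hi.norm.const_mul M) (ae_of_all _ fun x => ?_)
          rw [norm_mul]
          exact mul_le_mul_of_nonneg_right (hM _) (norm_nonneg _)
      _ = M * (eLpNorm (fun x => (inner ℝ (w x) (G n x - G' x) : ℝ)) 1 μ).toReal := by
          rw [integral_const_mul, eLpNorm_one_eq_lintegral_enorm,
            integral_norm_eq_lintegral_enorm hi.1]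
      _ ≤ _ := by
          refine mul_le_mul_of_nonneg_left (ENNReal.toReal_mono
            (ENNReal.mul_ne_top hw.2.ne (hsub n).2.ne) (eLpNorm_inner_le hw (hsub n)))
            ((abs_nonneg _).trans (hM 0))
  have h3 := h2.add h1
  rw [zero_add] at h3
  refine h3.congr fun n => ?_
  rw [← integral_add]
  · refine integral_congr_ae (ae_of_all _ fun x => ?_)
    simp only [inner_sub_right]
    ring
  · exact integrable_comp_mul hψ hM (hv n) (hw.integrable_inner_of_holderConjugate (hsub n))
  · exact integrable_comp_mul hψ hM (hv n) (hw.integrable_inner_of_holderConjugate hG')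

end Products

/-! ### Test functions and traces on the axis -/

/-- The composition `F ∘ φ` of a test function `φ` with a smooth function `F` vanishing at zero. -/
noncomputable def testComp {Ω : Opens E3} (F : ℝ → ℝ) (hF : ContDiff ℝ (⊤ : ℕ∞) F) (h0 : F 0 = 0)
    (φ : 𝓓(Ω, ℝ)) : 𝓓(Ω, ℝ) where
  toFun := fun x => F (φ x)
  contDiff' := hF.comp φ.contDiff
  hasCompactSupport' := φ.hasCompactSupport.comp_left h0
  tsupport_subset' := (tsupport_comp_subset h0 φ).trans φ.tsupport_subset

theorem testComp_apply {Ω : Opens E3} {F : ℝ → ℝ} (hF : ContDiff ℝ (⊤ : ℕ∞) F) (h0 : F 0 = 0)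
    (φ : 𝓓(Ω, ℝ)) (x : E3) : testComp F hF h0 φ x = F (φ x) := rfl

theorem contDiff_one_testFunction {Ω : Opens E3} (φ : 𝓓(Ω, ℝ)) : ContDiff ℝ 1 φ :=
  φ.contDiff.of_le (by exact_mod_cast le_top)

theorem gradient_testComp {Ω : Opens E3} {F F' : ℝ → ℝ} (hF : ContDiff ℝ (⊤ : ℕ∞) F) (h0 : F 0 = 0)
    (hF' : ∀ s, HasDerivAt F (F' s) s) (φ : 𝓓(Ω, ℝ)) (x : E3) :
    gradient (testComp F hF h0 φ) x = F' (φ x) • gradient φ x := by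
  have h1 : HasFDerivAt φ (fderiv ℝ φ x) x :=
    ((contDiff_one_testFunction φ).differentiable one_ne_zero x).hasFDerivAt
  have h2 : HasFDerivAt (testComp F hF h0 φ) (F' (φ x) • fderiv ℝ φ x) x :=
    (hF' (φ x)).comp_hasFDerivAt x h1
  rw [gradient, h2.fderiv, map_smul, gradient]

theorem memLp_gradient {Ω : Opens E3} (φ : 𝓓(Ω, ℝ)) (P : ℝ≥0∞) {μ : Measure E3}
    [IsFiniteMeasure μ] : MemLp (gradient φ) P μ := by
  obtain ⟨C, hC⟩ := exists_norm_gradient_le (contDiff_one_testFunction φ) φ.hasCompactSupport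
  exact MemLp.of_bound
    (continuous_gradient (contDiff_one_testFunction φ)).measurable.aestronglyMeasurable C
    (ae_of_all _ hC)

theorem continuous_axisPoint : Continuous fun t : ℝ => (!₂[0, 0, t] : E3) := by
  refine (PiLp.continuous_toLp 2 _).comp (continuous_pi fun i => ?_)
  fin_cases i <;> simp <;> fun_prop

theorem measurableSet_axis (Ω : Opens E3) : MeasurableSet (axis Ω) :=
  (isClosed_closure.inter (isClosed_eq continuous_horizontal continuous_const)).measurableSet

theorem axisMeasure_univ_lt_top {Ω : Opens E3} (hΩ : Bornology.IsBounded (Ω : Set E3)) :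
    axisMeasure Ω Set.univ < ∞ := by
  obtain ⟨R, hR⟩ := hΩ.closure.subset_closedBall 0
  rw [axisMeasure, Measure.restrict_apply_univ,
    Measure.map_apply continuous_axisPoint.measurable (measurableSet_axis Ω)]
  have hsub : (fun t : ℝ => (!₂[0, 0, t] : E3)) ⁻¹' axis Ω ⊆ Set.Icc (-R) R := by
    intro t ht
    have h := hR ht.1
    rw [mem_closedBall_zero_iff] at h
    rw [Set.mem_Icc, ← abs_le]
    exact (PiLp.norm_apply_le (!₂[0, 0, t] : E3) 2).trans h
  exact (measure_mono hsub).trans_lt (by simp)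

/-- The line integral of a function supported in `Ω` is the integral over `Γ`. -/
theorem integral_axisPoint_eq {Ω : Opens E3} (η : 𝓓(Ω, ℝ)) :
    ∫ z : ℝ, η !₂[0, 0, z] = ∫ x, η x ∂axisMeasure Ω := by
  rw [axisMeasure, setIntegral_eq_integral_of_ae_compl_eq_zero,
    integral_map continuous_axisPoint.measurable.aemeasurable
      η.continuous.measurable.aestronglyMeasurable]
  rw [ae_map_iff continuous_axisPoint.measurable.aemeasurable]
  · refine ae_of_all _ fun z hz => ?_
    refine image_eq_zero_of_notMem_tsupport fun hmem =>
      hz ⟨subset_closure (η.tsupport_subset hmem), ?_⟩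
    ext i
    fin_cases i <;> simp [horizontal]
  · have : {x | x ∉ axis Ω → η x = 0} = axis Ω ∪ {x | η x = 0} := by
      ext x; simp [imp_iff_not_or]
    rw [this]
    exact (measurableSet_axis Ω).union (isClosed_eq η.continuous continuous_const).measurableSet

/-- If the traces of `φ n` on `Γ` tend to zero in `Lₚ`, so do the line integrals of `H(φ n)` for
every `H` of at most linear growth, because `Γ` has finite length. -/
theorem tendsto_integral_axis {Ω : Opens E3} (hΩ : Bornology.IsBounded (Ω : Set E3)) {P : ℝ≥0∞}
    (hP : 1 ≤ P) {φ : ℕ → 𝓓(Ω, ℝ)}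
    (hφ : Tendsto (fun n => eLpNorm (φ n) P (axisMeasure Ω)) atTop (𝓝 0))
    {H : ℝ → ℝ} (hHs : ContDiff ℝ (⊤ : ℕ∞) H) (h0 : H 0 = 0) {C : ℝ}
    (hH : ∀ s, |H s| ≤ C * |s|) :
    Tendsto (fun n => ∫ z : ℝ, testComp H hHs h0 (φ n) !₂[0, 0, z]) atTop (𝓝 0) := by
  have hfin := axisMeasure_univ_lt_top hΩ
  set ν := axisMeasure Ω with hν
  set e : ℝ := 1 / (1 : ℝ≥0∞).toReal - 1 / P.toReal with he
  have he0 : 0 ≤ e := by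
    rcases eq_or_ne P ∞ with h | h
    · simp [he, h]
    · have h1 : 1 ≤ P.toReal := by
        rw [← ENNReal.toReal_one]; exact ENNReal.toReal_mono h hP
      rw [he, ENNReal.toReal_one, div_one, sub_nonneg]
      exact div_le_one_of_le₀ h1 (by linarith)
  have hK : ν Set.univ ^ e ≠ ∞ := (ENNReal.rpow_lt_top_of_nonneg he0 hfin.ne).ne
  have hlim : Tendsto (fun n => (ENNReal.ofReal C * (eLpNorm (φ n) P ν * ν Set.univ ^ e)).toReal)
      atTop (𝓝 0) := by
    have h1 := ENNReal.Tendsto.mul_const hφ (Or.inr hK)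
    have h2 := ENNReal.Tendsto.const_mul h1 (Or.inr (ENNReal.ofReal_ne_top (r := C)))
    rw [zero_mul, mul_zero] at h2
    exact (ENNReal.tendsto_toReal ENNReal.zero_ne_top).comp h2
  have hlt : ∀ᶠ n in atTop, eLpNorm (φ n) P ν < 1 := hφ.eventually_lt_const one_pos
  refine squeeze_zero_norm' ?_ hlim
  filter_upwards [hlt] with n hn
  rw [integral_axisPoint_eq]
  have hmeas : AEStronglyMeasurable (φ n) ν := (φ n).continuous.measurable.aestronglyMeasurable
  have hbd : eLpNorm (testComp H hHs h0 (φ n)) 1 ν ≤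
      ENNReal.ofReal C * (eLpNorm (φ n) P ν * ν Set.univ ^ e) :=
    (eLpNorm_le_mul_eLpNorm_of_ae_le_mul (ae_of_all _ fun x => hH (φ n x)) 1).trans
      (mul_le_mul_right (eLpNorm_le_eLpNorm_mul_rpow_measure_univ hP hmeas) _)
  refine (norm_integral_le_lintegral_norm _).trans ?_
  refine ENNReal.toReal_mono ?_ ?_
  · exact ENNReal.mul_ne_top ENNReal.ofReal_ne_top
      (ENNReal.mul_ne_top (hn.trans ENNReal.one_lt_top).ne hK)
  · refine le_trans (le_of_eq ?_) hbd
    simp only [eLpNorm_one_eq_lintegral_enorm, ofReal_norm, hν]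

theorem drift_eq (b : E3 → E3) (α : ℝ) (x : E3) : drift b α x = b x + α • lineSource x := by
  rw [drift, lineSource, smul_smul, mul_one_div]

theorem setIntegral_inner_gradient_eq {Ω : Opens E3} (η : 𝓓(Ω, ℝ)) (w : E3 → E3) :
    ∫ x in (Ω : Set E3), inner ℝ (w x) (gradient η x) = ∫ x, inner ℝ (w x) (gradient η x) := by
  refine setIntegral_eq_integral_of_forall_compl_eq_zero fun x hx => ?_
  rw [gradient_eq_zero_of_notMem_tsupport fun h => hx (η.tsupport_subset h), inner_zero_right]

/-- The drift acts on test functions through the line source only. -/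
theorem integral_drift_gradient {Ω : Opens E3} {P' P : ℝ≥0∞} [P'.HolderConjugate P]
    [IsFiniteMeasure (volume.restrict (Ω : Set E3))] {b : E3 → E3} (α : ℝ)
    (hb : MemLp b P' (volume.restrict Ω)) (hdiv : DivergenceFree Ω b) (η : 𝓓(Ω, ℝ)) :
    ∫ x in (Ω : Set E3), inner ℝ (drift b α x) (gradient η x) =
      -(2 * Real.pi * α) * ∫ z : ℝ, η !₂[0, 0, z] := by
  have hη := contDiff_one_testFunction η
  have h1 := hb.integrable_inner_of_holderConjugate (memLp_gradient η P)
  have h2 := (integrable_inner_lineSource_gradient hη η.hasCompactSupport).integrableOn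
    (s := (Ω : Set E3))
  simp_rw [drift_eq, inner_add_left, real_inner_smul_left]
  rw [integral_add h1 (h2.const_mul α), hdiv η, integral_const_mul, setIntegral_inner_gradient_eq,
    integral_inner_lineSource_gradient hη η.hasCompactSupport]
  ring

/-! ### The energy identity -/

/-- **Energy identity.** If the test functions `φ n` approximate `u` in `W¹ₚ(Ω)` and their traces
on the axis tend to zero, the drift does not contribute when the equation is tested with a
truncation `T(u)`: the drift term is the limit of `∫ b₀ · ∇H(φ n)`, a multiple of the line integral
of `H(φ n)`. -/
theorem energy_identity {Ω : Opens E3} (hΩ : Bornology.IsBounded (Ω : Set E3)) {P' P : ℝ≥0∞}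
    [P'.HolderConjugate P] [IsFiniteMeasure (volume.restrict (Ω : Set E3))] {b f g : E3 → E3}
    {α : ℝ} {u : E3 → ℝ} (hb : MemLp b P' (volume.restrict Ω))
    (hsource : MemLp lineSource P' (volume.restrict Ω)) (hdiv : DivergenceFree Ω b)
    (hf : MemLp f P' (volume.restrict Ω)) (hg : MemLp g P (volume.restrict Ω))
    (hg' : MemLp g P' (volume.restrict Ω))
    (hweak : ∀ η : 𝓓(Ω, ℝ),
      (∫ x in (Ω : Set E3), inner ℝ (g x) (gradient η x)) +
          (∫ x in (Ω : Set E3), η x * inner ℝ (drift b α x) (g x)) =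
        ∫ x in (Ω : Set E3), inner ℝ (f x) (gradient η x))
    {φ : ℕ → 𝓓(Ω, ℝ)}
    (hφu : ∀ᵐ x ∂volume.restrict Ω, Tendsto (fun n => φ n x) atTop (𝓝 (u x)))
    (hφg : Tendsto (fun n => eLpNorm (fun x => gradient (φ n) x - g x) P (volume.restrict Ω))
      atTop (𝓝 0))
    (hφΓ : Tendsto (fun n => eLpNorm (φ n) P (axisMeasure Ω)) atTop (𝓝 0))
    {κ k h : ℝ} (S : SmoothTruncation κ k h) :
    ∫ x in (Ω : Set E3), S.T' (u x) * inner ℝ (g x) (g x) =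
      ∫ x in (Ω : Set E3), S.T' (u x) * inner ℝ (f x) (g x) := by
  have hP : 1 ≤ P := ENNReal.HolderConjugate.one_le P P'
  have hdrift : MemLp (drift b α) P' (volume.restrict Ω) := by
    have : drift b α = fun x => b x + α • lineSource x := funext (drift_eq b α)
    rw [this]
    exact hb.add (hsource.const_smul α)
  have hT' : ∀ s, |S.T' s| ≤ 1 := fun s => by
    rw [abs_of_nonneg (S.T'_nonneg s)]; exact S.T'_le_one s
  have hmeas : ∀ n, AEStronglyMeasurable (φ n) (volume.restrict (Ω : Set E3)) := fun n =>
    (φ n).continuous.measurable.aestronglyMeasurable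
  have hG : ∀ n, MemLp (gradient (φ n)) P (volume.restrict (Ω : Set E3)) := fun n =>
    memLp_gradient (φ n) P
  have lim_g := tendsto_integral_comp_mul_inner S.continuous_T' hT' hmeas hφu hg' hg hG hφg
  have lim_f := tendsto_integral_comp_mul_inner S.continuous_T' hT' hmeas hφu hf hg hG hφg
  have lim_b := tendsto_integral_comp_mul S.contDiff_T.continuous S.abs_T_le hmeas hφu
    (hdrift.integrable_inner_of_holderConjugate hg)
  have lim_b' := tendsto_integral_comp_mul_inner S.contDiff_T.continuous S.abs_T_le hmeas hφu
    hdrift hg hG hφg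
  have hzero : ∫ x in (Ω : Set E3), S.T (u x) * inner ℝ (drift b α x) (g x) = 0 := by
    have h1 := (tendsto_integral_axis hΩ hP hφΓ S.contDiff_H S.H_zero S.abs_H_le).const_mul
      (-(2 * Real.pi * α))
    rw [mul_zero] at h1
    refine tendsto_nhds_unique lim_b' (h1.congr fun n => ?_)
    rw [← integral_drift_gradient (P := P) α hb hdiv]
    simp_rw [gradient_testComp S.contDiff_H S.H_zero S.hasDerivAt_H, real_inner_smul_right]
  have hsum := lim_g.add lim_b
  rw [hzero, add_zero] at hsum
  refine tendsto_nhds_unique hsum (lim_f.congr fun n => ?_)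
  have := hweak (testComp S.T S.contDiff_T S.T_zero (φ n))
  simp_rw [gradient_testComp S.contDiff_T S.T_zero S.hasDerivAt_T, real_inner_smul_right,
    testComp_apply] at this
  exact this.symm

/-! ### Decay of the superlevel sets -/

theorem eLpNorm_two_eq_integral {X E : Type*} [MeasurableSpace X] {μ : Measure X}
    [NormedAddCommGroup E] {f : X → E} (hf : MemLp f 2 μ) :
    eLpNorm f 2 μ = ENNReal.ofReal ((∫ x, ‖f x‖ ^ 2 ∂μ) ^ (1 / 2 : ℝ)) := by
  rw [hf.eLpNorm_eq_integral_rpow_norm two_ne_zero ENNReal.ofNat_ne_top]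
  simp

theorem memLp_comp_smul {X E : Type*} [MeasurableSpace X] {μ : Measure X}
    [NormedAddCommGroup E] [NormedSpace ℝ E] {P : ℝ≥0∞} {ψ : ℝ → ℝ} (hψ : Continuous ψ)
    (hψ1 : ∀ s, |ψ s| ≤ 1) {v : X → ℝ} (hv : AEStronglyMeasurable v μ) {g : X → E}
    (hg : MemLp g P μ) : MemLp (fun x => ψ (v x) • g x) P μ := by
  refine hg.of_le ((hψ.comp_aestronglyMeasurable hv).smul hg.1) (ae_of_all _ fun x => ?_)
  rw [norm_smul]
  exact mul_le_of_le_one_left (norm_nonneg _) (hψ1 _)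

/-- The **Sobolev inequality** on `Ω` for test functions. -/
theorem eLpNorm_six_le_eLpNorm_gradient {Ω : Opens E3} (η : 𝓓(Ω, ℝ)) :
    eLpNorm η 6 (volume.restrict Ω) ≤ eLpNormLESNormFDerivOfEqInnerConst (volume : Measure E3) 2 *
      eLpNorm (gradient η) 2 (volume.restrict Ω) := by
  have h := eLpNorm_le_eLpNorm_fderiv_of_eq_inner (volume : Measure E3)
    (contDiff_one_testFunction η) η.hasCompactSupport (p := 2) (p' := 6) (by norm_num)
    (by simp) (by simp; norm_num)
  have hgrad : eLpNorm (fderiv ℝ η) 2 (volume : Measure E3) =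
      eLpNorm (gradient η) 2 (volume.restrict Ω) := by
    rw [eLpNorm_restrict_eq_of_support_subset]
    · exact eLpNorm_congr_norm_ae (ae_of_all _ fun x => by simp [gradient])
    · intro x hx
      by_contra hxΩ
      exact hx (gradient_eq_zero_of_notMem_tsupport fun hm => hxΩ (η.tsupport_subset hm))
  have h2 : ((2 : ℝ≥0) : ℝ≥0∞) = 2 := rfl
  have h6 : ((6 : ℝ≥0) : ℝ≥0∞) = 6 := rfl
  rw [h2, h6, hgrad] at h
  exact (eLpNorm_mono_measure _ Measure.restrict_le_self).trans h

/-- The Sobolev inequality passes to the truncation `T(u)` of the limit `u` of test functions. -/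
theorem eLpNorm_truncation_le {Ω : Opens E3} [IsFiniteMeasure (volume.restrict (Ω : Set E3))]
    {P : ℝ≥0∞} (hP : 2 ≤ P) {g : E3 → E3} {u : E3 → ℝ} (hg : MemLp g P (volume.restrict Ω))
    (hu : AEStronglyMeasurable u (volume.restrict Ω)) {φ : ℕ → 𝓓(Ω, ℝ)}
    (hφu : ∀ᵐ x ∂volume.restrict Ω, Tendsto (fun n => φ n x) atTop (𝓝 (u x)))
    (hφg : Tendsto (fun n => eLpNorm (fun x => gradient (φ n) x - g x) P (volume.restrict Ω))
      atTop (𝓝 0)) {κ k h : ℝ} (S : SmoothTruncation κ k h) :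
    eLpNorm (fun x => S.T (u x)) 6 (volume.restrict Ω) ≤
      eLpNormLESNormFDerivOfEqInnerConst (volume : Measure E3) 2 *
        eLpNorm (fun x => S.T' (u x) • g x) 2 (volume.restrict Ω) := by
  set μ := volume.restrict (Ω : Set E3) with hμ
  set C : ℝ≥0∞ := ↑(eLpNormLESNormFDerivOfEqInnerConst (volume : Measure E3) 2) with hC
  have hT' : ∀ s, |S.T' s| ≤ 1 := fun s => by
    rw [abs_of_nonneg (S.T'_nonneg s)]; exact S.T'_le_one s
  have hmeas : ∀ n, AEStronglyMeasurable (φ n) μ := fun n =>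
    (φ n).continuous.measurable.aestronglyMeasurable
  have hg2 : MemLp g 2 μ := hg.mono_exponent hP
  have hlim1 : Tendsto (fun n => eLpNorm (fun x => S.T' (φ n x) • g x) 2 μ) atTop
      (𝓝 (eLpNorm (fun x => S.T' (u x) • g x) 2 μ)) := by
    have hi : Integrable (fun x => ‖g x‖ ^ 2) μ := hg2.integrable_norm_pow two_ne_zero
    have := tendsto_integral_comp_mul (ψ := fun s => S.T' s ^ 2) (S.continuous_T'.pow 2) (M := 1)
      (fun s => by
        rw [abs_pow]; exact pow_le_one₀ (abs_nonneg _) (hT' s)) hmeas hφu hi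
    have h2 := ENNReal.tendsto_ofReal (this.rpow_const (p := 1 / 2) (Or.inr (by norm_num)))
    rw [eLpNorm_two_eq_integral (memLp_comp_smul S.continuous_T' hT' hu hg2)]
    simp_rw [eLpNorm_two_eq_integral (memLp_comp_smul S.continuous_T' hT' (hmeas _) hg2),
      norm_smul, mul_pow, Real.norm_eq_abs, sq_abs]
    exact h2
  have hlim2 : Tendsto (fun n => eLpNorm (fun x => gradient (φ n) x - g x) 2 μ) atTop (𝓝 0) := by
    have hK : μ Set.univ ^ (1 / (2 : ℝ≥0∞).toReal - 1 / P.toReal) ≠ ∞ := by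
      refine (ENNReal.rpow_lt_top_of_nonneg ?_ (measure_ne_top μ _)).ne
      rcases eq_or_ne P ∞ with h | h
      · simp [h]
      · have : (2 : ℝ≥0∞).toReal ≤ P.toReal := ENNReal.toReal_mono h hP
        exact sub_nonneg.2 (one_div_le_one_div_of_le (by simp) this)
    have h1 := ENNReal.Tendsto.mul_const hφg (Or.inr hK)
    rw [zero_mul] at h1
    refine tendsto_of_tendsto_of_tendsto_of_le_of_le tendsto_const_nhds h1 (fun _ => zero_le)
      fun n => ?_
    exact eLpNorm_le_eLpNorm_mul_rpow_measure_univ hP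
      ((memLp_gradient (φ n) P).sub hg).1
  have hbound : ∀ n, eLpNorm (fun x => S.T (φ n x)) 6 μ ≤
      C * (eLpNorm (fun x => S.T' (φ n x) • g x) 2 μ +
        eLpNorm (fun x => gradient (φ n) x - g x) 2 μ) := by
    intro n
    refine (eLpNorm_six_le_eLpNorm_gradient
      (testComp S.T S.contDiff_T S.T_zero (φ n))).trans (mul_le_mul_right ?_ C)
    have hsub : MemLp (fun x => gradient (φ n) x - g x) 2 μ := (memLp_gradient (φ n) 2).sub hg2
    have heq : gradient (testComp S.T S.contDiff_T S.T_zero (φ n)) =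
        (fun x => S.T' (φ n x) • g x) + fun x => S.T' (φ n x) • (gradient (φ n) x - g x) := by
      funext x
      rw [gradient_testComp S.contDiff_T S.T_zero S.hasDerivAt_T, Pi.add_apply, smul_sub]
      abel
    rw [heq]
    refine (eLpNorm_add_le (memLp_comp_smul S.continuous_T' hT' (hmeas n) hg2).1
      (memLp_comp_smul S.continuous_T' hT' (hmeas n) hsub).1 one_le_two).trans
      (add_le_add le_rfl ?_)
    refine eLpNorm_mono_ae (ae_of_all _ fun x => ?_)
    rw [norm_smul]
    exact mul_le_of_le_one_left (norm_nonneg _) (hT' _)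
  have hlim := ENNReal.Tendsto.const_mul (a := C) (hlim1.add hlim2) (Or.inr ENNReal.coe_ne_top)
  rw [add_zero] at hlim
  have hTc := S.contDiff_T.continuous
  refine (Lp.eLpNorm_lim_le_liminf_eLpNorm
    (fun n => hTc.comp_aestronglyMeasurable (hmeas n)) _ ?_).trans
    ((liminf_le_liminf (Eventually.of_forall hbound)).trans_eq hlim.liminf_eq)
  filter_upwards [hφu] with x hx
  exact (hTc.tendsto _).comp hx

/-- The energy identity bounds the gradient of the truncation by the norm of `f` over the
superlevel set. -/
theorem eLpNorm_truncation_gradient_le {X E : Type*} [MeasurableSpace X] {μ : Measure X}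
    [NormedAddCommGroup E] [InnerProductSpace ℝ E] {f g : X → E} {u : X → ℝ} (hf : MemLp f 2 μ)
    (hg : MemLp g 2 μ) (hu : AEStronglyMeasurable u μ) {κ k h : ℝ} (S : SmoothTruncation κ k h)
    (henergy : ∫ x, S.T' (u x) * inner ℝ (g x) (g x) ∂μ =
      ∫ x, S.T' (u x) * inner ℝ (f x) (g x) ∂μ) :
    eLpNorm (fun x => S.T' (u x) • g x) 2 μ ≤ eLpNorm f 2 (μ.restrict {x | k < |u x|}) := by
  have hT' : ∀ s, |S.T' s| ≤ 1 := fun s => by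
    rw [abs_of_nonneg (S.T'_nonneg s)]; exact S.T'_le_one s
  have hset : NullMeasurableSet {x | k < |u x|} μ :=
    nullMeasurableSet_lt aemeasurable_const hu.aemeasurable.abs
  have hf2 : Integrable (fun x => ‖f x‖ ^ 2) μ := hf.integrable_norm_pow two_ne_zero
  have hg2 : Integrable (fun x => ‖g x‖ ^ 2) μ := hg.integrable_norm_pow two_ne_zero
  have hTf := integrable_comp_mul S.continuous_T' hT' hu hf2
  have hTg := integrable_comp_mul S.continuous_T' hT' hu hg2
  have hTfg := integrable_comp_mul S.continuous_T' hT' hu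
    (hf.integrable_inner_of_holderConjugate (P := 2) (P' := 2) hg)
  have hEB : ∫ x, S.T' (u x) * ‖g x‖ ^ 2 ∂μ ≤ ∫ x, S.T' (u x) * ‖f x‖ ^ 2 ∂μ := by
    simp_rw [real_inner_self_eq_norm_sq] at henergy
    have h1 : ∫ x, S.T' (u x) * inner ℝ (f x) (g x) ∂μ ≤
        ∫ x, (S.T' (u x) * ‖f x‖ ^ 2 + S.T' (u x) * ‖g x‖ ^ 2) / 2 ∂μ := by
      refine integral_mono hTfg ((hTf.add hTg).div_const 2) fun x => ?_
      have h2 := real_inner_le_norm (f x) (g x)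
      have h3 : (inner ℝ (f x) (g x) : ℝ) ≤ (‖f x‖ ^ 2 + ‖g x‖ ^ 2) / 2 := by
        nlinarith [sq_nonneg (‖f x‖ - ‖g x‖)]
      calc S.T' (u x) * inner ℝ (f x) (g x) ≤ S.T' (u x) * ((‖f x‖ ^ 2 + ‖g x‖ ^ 2) / 2) :=
            mul_le_mul_of_nonneg_left h3 (S.T'_nonneg _)
        _ = _ := by ring
    rw [integral_div, integral_add hTf hTg, ← henergy] at h1
    linarith
  rw [eLpNorm_two_eq_integral (memLp_comp_smul S.continuous_T' hT' hu hg),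
    eLpNorm_two_eq_integral (hf.restrict _)]
  refine ENNReal.ofReal_le_ofReal (Real.rpow_le_rpow (integral_nonneg fun x => by positivity) ?_
    (by norm_num))
  calc ∫ x, ‖S.T' (u x) • g x‖ ^ 2 ∂μ ≤ ∫ x, S.T' (u x) * ‖g x‖ ^ 2 ∂μ := by
        refine integral_mono_of_nonneg (ae_of_all _ fun x => by positivity) hTg
          (ae_of_all _ fun x => ?_)
        simp only [norm_smul, mul_pow, Real.norm_eq_abs, sq_abs]
        refine mul_le_mul_of_nonneg_right ?_ (by positivity)
        nlinarith [S.T'_nonneg (u x), S.T'_le_one (u x)]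
    _ ≤ ∫ x, S.T' (u x) * ‖f x‖ ^ 2 ∂μ := hEB
    _ ≤ ∫ x, {x | k < |u x|}.indicator (fun x => ‖f x‖ ^ 2) x ∂μ := by
        refine integral_mono hTf (hf2.indicator₀ hset) fun x => ?_
        by_cases hx : k < |u x|
        · rw [Set.indicator_of_mem (show x ∈ {x | k < |u x|} from hx)]
          exact mul_le_of_le_one_left (by positivity) (S.T'_le_one _)
        · rw [Set.indicator_of_notMem (show x ∉ {x | k < |u x|} from hx)]
          simp [S.T'_eq_zero _ (not_lt.1 hx)]
    _ = ∫ x in {x | k < |u x|}, ‖f x‖ ^ 2 ∂μ := integral_indicator₀ hset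

/-- Decay of the superlevel sets of `u`, obtained from the Sobolev and energy estimates for a
truncation between the levels `k < h` by Chebyshev's and Hölder's inequalities. -/
theorem measureReal_superlevel_le {X E : Type*} [MeasurableSpace X] {μ : Measure X}
    [IsFiniteMeasure μ] [NormedAddCommGroup E] {f : X → E} {q : ℝ} (hq : 2 ≤ q)
    (hf : MemLp f (ENNReal.ofReal q) μ) {u : X → ℝ} (hu : AEStronglyMeasurable u μ) {κ k h : ℝ}
    (hκ : 0 < κ) (hkh : k < h) (S : SmoothTruncation κ k h) {C : ℝ≥0}
    (hS : eLpNorm (fun x => S.T (u x)) 6 μ ≤ C * eLpNorm f 2 (μ.restrict {x | k < |u x|})) :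
    μ.real {x | h < |u x|} ≤
      (C * (eLpNorm f (ENNReal.ofReal q) μ).toReal / κ / (h - k)) ^ 6 *
        μ.real {x | k < |u x|} ^ (3 - 6 / q) := by
  set F := eLpNorm f (ENNReal.ofReal q) μ with hF
  have hδ : 0 < κ * (h - k) := mul_pos hκ (by linarith)
  have hholder : eLpNorm f 2 (μ.restrict {x | k < |u x|}) ≤
      F * μ {x | k < |u x|} ^ (1 / 2 - 1 / q) := by
    have h1 := eLpNorm_le_eLpNorm_mul_rpow_measure_univ
      (μ := μ.restrict {x | k < |u x|}) (p := 2) (q := ENNReal.ofReal q) (f := f)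
      (by rw [← ENNReal.ofReal_ofNat]; exact ENNReal.ofReal_le_ofReal hq) hf.1.restrict
    rw [Measure.restrict_apply_univ, ENNReal.toReal_ofReal (by linarith), ENNReal.toReal_ofNat]
      at h1
    exact h1.trans (mul_le_mul_left (eLpNorm_mono_measure _ Measure.restrict_le_self) _)
  have hcheb : ENNReal.ofReal (κ * (h - k)) ^ 6 * μ {x | h < |u x|} ≤
      eLpNorm (fun x => S.T (u x)) 6 μ ^ 6 := by
    have h1 := mul_meas_ge_le_pow_eLpNorm' μ (p := 6) (f := fun x => S.T (u x)) (by norm_num)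
      (by norm_num) (S.contDiff_T.continuous.comp_aestronglyMeasurable hu)
      (ENNReal.ofReal (κ * (h - k)))
    simp only [ENNReal.toReal_ofNat, ENNReal.rpow_ofNat] at h1
    refine le_trans (mul_le_mul_right (measure_mono fun x hx => ?_) _) h1
    have h2 := S.le_abs_T (u x) (le_of_lt hx)
    simp only [Set.mem_ofPred_eq, ← ofReal_norm, Real.norm_eq_abs]
    exact ENNReal.ofReal_le_ofReal h2
  have hall : ENNReal.ofReal (κ * (h - k)) ^ 6 * μ {x | h < |u x|} ≤
      (C * (F * μ {x | k < |u x|} ^ (1 / 2 - 1 / q))) ^ 6 :=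
    hcheb.trans (pow_le_pow_left' (hS.trans (mul_le_mul_right hholder _)) 6)
  have he : 0 ≤ 1 / 2 - 1 / q := sub_nonneg.2 (one_div_le_one_div_of_le two_pos hq)
  have hreal := ENNReal.toReal_mono (by
    refine ENNReal.pow_ne_top (ENNReal.mul_ne_top ENNReal.coe_ne_top
      (ENNReal.mul_ne_top hf.2.ne ?_))
    exact (ENNReal.rpow_lt_top_of_nonneg he (measure_ne_top μ _)).ne) hall
  simp only [ENNReal.toReal_mul, ENNReal.toReal_pow, ENNReal.toReal_ofReal hδ.le,
    ← ENNReal.toReal_rpow, ENNReal.coe_toReal] at hreal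
  have hpow : (μ.real {x | k < |u x|} ^ (1 / 2 - 1 / q)) ^ 6 =
      μ.real {x | k < |u x|} ^ (3 - 6 / q) := by
    rw [← Real.rpow_natCast, ← Real.rpow_mul measureReal_nonneg]
    congr 1
    push_cast
    ring
  rw [← hpow]
  have hδ6 : 0 < (κ * (h - k)) ^ 6 := by positivity
  rw [← mul_le_mul_iff_right₀ hδ6]
  refine hreal.trans (le_of_eq ?_)
  have hhk : h - k ≠ 0 := by linarith
  simp only [measureReal_def]
  field_simp

/-! ### The maximum estimate -/

/-- The constant that the iteration yields for a domain of volume `V`. -/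
noncomputable def maxConst (C κ V q : ℝ) : ℝ :=
  C / κ * (V ^ (2 - 6 / q) * (2 : ℝ) ^ (6 * (3 - 6 / q) / (2 - 6 / q)) + 1) + 1

theorem maxConst_pos {C κ V q : ℝ} (hC : 0 ≤ C) (hκ : 0 < κ) (hV : 0 ≤ V) :
    0 < maxConst C κ V q := by
  unfold maxConst; positivity

/-- The decay of the superlevel sets implies an essential bound. -/
theorem eLpNorm_top_le_of_superlevel_decay {X : Type*} [MeasurableSpace X] {μ : Measure X}
    [IsFiniteMeasure μ] {u : X → ℝ} {C κ F q : ℝ} (hC : 0 ≤ C) (hκ : 0 < κ) (hF : 0 ≤ F)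
    (hq : 3 < q)
    (hdecay : ∀ k h, 0 ≤ k → k < h → μ.real {x | h < |u x|} ≤
      (C * F / κ / (h - k)) ^ 6 * μ.real {x | k < |u x|} ^ (3 - 6 / q)) :
    eLpNorm u ∞ μ ≤ ENNReal.ofReal (maxConst C κ (μ.real Set.univ) q * F) := by
  set V := μ.real Set.univ with hV
  have hV0 : 0 ≤ V := measureReal_nonneg
  set c := maxConst C κ V q with hc
  have hc0 : 0 < c := maxConst_pos hC hκ hV0
  have hβ : 6 / q < 2 := by rw [div_lt_iff₀ (by linarith)]; linarith
  -- the bound is shown for every positive level `d ≥ c F`, so that `F = 0` needs no special care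
  have key : ∀ d, 0 < d → c * F ≤ d → μ.real {x | d < |u x|} = 0 := by
    intro d hd hcd
    refine stampacchia_iteration (Φ := fun k => μ.real {x | k < |u x|}) (C := C * F / κ)
      (β := 3 - 6 / q) (by linarith) hd (fun _ _ => measureReal_nonneg)
      (fun k h _ hkh => measureReal_mono fun x hx => lt_of_le_of_lt hkh hx) hdecay ?_
    have hexp : 3 - 6 / q - 1 = 2 - 6 / q := by ring
    rw [hexp]
    set M := V ^ (2 - 6 / q) * (2 : ℝ) ^ (6 * (3 - 6 / q) / (2 - 6 / q)) with hM
    have hM0 : 0 ≤ M := by positivity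
    have h1 : μ.real {x | 0 < |u x|} ^ (2 - 6 / q) ≤ V ^ (2 - 6 / q) :=
      Real.rpow_le_rpow measureReal_nonneg (measureReal_mono (Set.subset_univ _)) (by linarith)
    have h2 : C * F / κ / d * (M + 1) ≤ 1 := by
      rw [div_mul_eq_mul_div, div_le_one hd]
      refine le_trans ?_ hcd
      have : C * F / κ * (M + 1) = (c - 1) * F := by rw [hc, maxConst]; ring
      rw [this]
      nlinarith
    have h3 : 0 ≤ C * F / κ / d := by positivity
    calc (C * F / κ / d) ^ 6 * μ.real {x | 0 < |u x|} ^ (2 - 6 / q) *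
          (2 : ℝ) ^ (6 * (3 - 6 / q) / (2 - 6 / q))
        ≤ (C * F / κ / d) ^ 6 * V ^ (2 - 6 / q) *
          (2 : ℝ) ^ (6 * (3 - 6 / q) / (2 - 6 / q)) := by gcongr
      _ = (C * F / κ / d) ^ 6 * M := by rw [hM]; ring
      _ ≤ (C * F / κ / d) ^ 6 * (M + 1) ^ 6 := by
          gcongr
          exact (le_add_of_nonneg_right zero_le_one).trans
            (le_self_pow₀ (by linarith) (by norm_num))
      _ = (C * F / κ / d * (M + 1)) ^ 6 := by rw [mul_pow]
      _ ≤ 1 := pow_le_one₀ (by positivity) h2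
  refine ENNReal.le_of_forall_pos_le_add fun ε hε _ => ?_
  have hd : 0 < c * F + ε := by positivity
  have h0 := key _ hd (by simp)
  rw [measureReal_eq_zero_iff] at h0
  have hae : ∀ᵐ x ∂μ, ‖u x‖ ≤ c * F + ε := by
    rw [ae_iff]
    simpa only [not_le, Real.norm_eq_abs] using h0
  rw [eLpNorm_exponent_top]
  refine (eLpNormEssSup_le_of_ae_bound hae).trans (le_of_eq ?_)
  rw [ENNReal.ofReal_add (by positivity) (by positivity), ENNReal.ofReal_coe_nnreal]

/-- Weak gradients are unique. -/
theorem MemSobolev.gradient_ae_eq {Ω : Opens E3} [IsFiniteMeasure (volume.restrict (Ω : Set E3))]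
    {P : ℝ≥0∞} (hP : 1 ≤ P) {u : E3 → ℝ} {g₁ g₂ : E3 → E3} (h₁ : MemSobolev Ω P u g₁)
    (h₂ : MemSobolev Ω P u g₂) : g₁ =ᵐ[volume.restrict Ω] g₂ := by
  have hi₁ : Integrable g₁ (volume.restrict Ω) := h₁.2.1.integrable hP
  have hi₂ : Integrable g₂ (volume.restrict Ω) := h₂.2.1.integrable hP
  have hloc : LocallyIntegrableOn (fun x => g₁ x - g₂ x) (Ω : Set E3) volume :=
    h₁.2.2.2.1.sub h₂.2.2.2.1
  have h := Ω.isOpen.ae_eq_zero_of_integral_contDiff_smul_eq_zero hloc fun η hη hc hsupp => ?_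
  · rw [Filter.EventuallyEq, ae_restrict_iff' Ω.isOpen.measurableSet]
    filter_upwards [h] with x hx hxΩ
    exact sub_eq_zero.1 (hx hxΩ)
  · let φ : 𝓓(Ω, ℝ) := ⟨η, hη, hc, hsupp⟩
    have e₁ := h₁.2.2.2.2 φ
    have e₂ := h₂.2.2.2.2 φ
    have he : ∫ x in (Ω : Set E3), φ x • g₁ x = ∫ x in (Ω : Set E3), φ x • g₂ x :=
      neg_injective (e₁.symm.trans e₂)
    obtain ⟨M, hM⟩ := φ.continuous.bounded_above_of_compact_support hc
    have hs : ∀ g : E3 → E3, Integrable g (volume.restrict Ω) →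
        Integrable (fun x => φ x • g x) (volume.restrict (Ω : Set E3)) := fun g hg =>
      hg.bdd_smul M φ.continuous.measurable.aestronglyMeasurable (ae_of_all _ hM)
    rw [← setIntegral_eq_integral_of_forall_compl_eq_zero (s := (Ω : Set E3)) fun x hx => by
      rw [image_eq_zero_of_notMem_tsupport fun hm => hx (hsupp hm), zero_smul]]
    change ∫ x in (Ω : Set E3), φ x • (g₁ x - g₂ x) = 0
    simp_rw [smul_sub]
    rw [integral_sub (hs g₁ hi₁) (hs g₂ hi₂)]
    exact sub_eq_zero.2 he

theorem theorem3p1 (Ω : Opens E3) (hΩ_conn : IsConnected (Ω : Set E3))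
    (hΩ_bdd : Bornology.IsBounded (Ω : Set E3)) (hΩ_lip : HasLipschitzBoundary (Ω : Set E3))
    (q : ℝ) (hq : 3 < q) :
    ∃ c : ℝ, 0 < c ∧
      ∀ (p : ℝ), 2 < p →
      ∀ (α : ℝ) (b f : E3 → E3),
        MemLp b (ENNReal.ofReal (p / (p - 1))) (volume.restrict Ω) →
        DivergenceFree Ω b →
        MemLp f (ENNReal.ofReal q) (volume.restrict Ω) →
        ∀ u : E3 → ℝ,
          IsWeakSolution Ω (ENNReal.ofReal p) (drift b α) f u →
          HasAxisTrace Ω (ENNReal.ofReal p) u 0 →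
          MemLp u ∞ (volume.restrict Ω) ∧
            eLpNorm u ∞ (volume.restrict Ω) ≤
              ENNReal.ofReal c * eLpNorm f (ENNReal.ofReal q) (volume.restrict Ω) := by
  have : IsFiniteMeasure (volume.restrict (Ω : Set E3)) :=
    ⟨by rw [Measure.restrict_apply_univ]; exact hΩ_bdd.measure_lt_top⟩
  obtain ⟨κ, hκ, hS⟩ := exists_smoothTruncation
  set C : ℝ≥0 := eLpNormLESNormFDerivOfEqInnerConst (volume : Measure E3) 2 with hC
  set μ := volume.restrict (Ω : Set E3) with hμ
  have hc : 0 < maxConst C κ (μ.real Set.univ) q := maxConst_pos C.2 hκ measureReal_nonneg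
  refine ⟨maxConst C κ (μ.real Set.univ) q, hc, ?_⟩
  intro p hp α b f hb hdiv hf u hsol htr
  obtain ⟨g, ⟨hsob, -⟩, hweak⟩ := hsol
  obtain ⟨-, g₂, hsob₂, φ, ⟨hφu, hφg⟩, hφΓ⟩ := htr
  set P := ENNReal.ofReal p with hPdef
  set P' := ENNReal.ofReal (p / (p - 1)) with hP'def
  have hconj : p.HolderConjugate (p / (p - 1)) := Real.HolderConjugate.conjExponent (by linarith)
  have : P'.HolderConjugate P := hconj.symm.ennrealOfReal
  have hp'2 : p / (p - 1) < 2 := by rw [div_lt_iff₀ (by linarith)]; linarith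
  have hP2 : 2 ≤ P := by
    rw [← ENNReal.ofReal_ofNat]; exact ENNReal.ofReal_le_ofReal hp.le
  have hq2 : (2 : ℝ≥0∞) ≤ ENNReal.ofReal q := by
    rw [← ENNReal.ofReal_ofNat]; exact ENNReal.ofReal_le_ofReal (by linarith)
  have hP'2 : P' ≤ 2 := by
    rw [← ENNReal.ofReal_ofNat]; exact ENNReal.ofReal_le_ofReal hp'2.le
  have hP1 : 1 ≤ P := one_le_two.trans hP2
  have hgg := MemSobolev.gradient_ae_eq hP1 hsob hsob₂
  -- along a subsequence the approximating test functions converge almost everywhere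
  obtain ⟨ns, hns, hae⟩ := (tendstoInMeasure_of_tendsto_eLpNorm (p := P)
    (zero_lt_one.trans_le hP1).ne' (fun n => (φ n).continuous.measurable.aestronglyMeasurable)
    hsob.1.1 hφu).exists_seq_tendsto_ae
  have hlim_g : Tendsto (fun n => eLpNorm (fun x => gradient (φ (ns n)) x - g x) P μ) atTop
      (𝓝 0) := by
    refine (hφg.comp hns.tendsto_atTop).congr fun n => ?_
    refine eLpNorm_congr_ae ?_
    filter_upwards [hgg] with x hx
    rw [hx]
  have hlim_Γ : Tendsto (fun n => eLpNorm (φ (ns n)) P (axisMeasure Ω)) atTop (𝓝 0) := by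
    simp only [Pi.zero_apply, sub_zero] at hφΓ
    exact hφΓ.comp hns.tendsto_atTop
  have hu : AEStronglyMeasurable u μ := hsob.1.1
  have hbound : eLpNorm u ∞ μ ≤ ENNReal.ofReal (maxConst C κ (μ.real Set.univ) q *
      (eLpNorm f (ENNReal.ofReal q) μ).toReal) := by
    refine eLpNorm_top_le_of_superlevel_decay C.2 hκ ENNReal.toReal_nonneg hq fun k h hk hkh => ?_
    obtain ⟨S⟩ := hS k h hk hkh
    refine measureReal_superlevel_le (by linarith) hf hu hκ hkh S ?_
    refine (eLpNorm_truncation_le hP2 hsob.2.1 hu hae hlim_g S).trans (mul_le_mul_right ?_ _)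
    refine eLpNorm_truncation_gradient_le (hf.mono_exponent hq2) (hsob.2.1.mono_exponent hP2) hu S
      ?_
    exact energy_identity hΩ_bdd (P' := P') (P := P) hb
      (memLp_lineSource hconj.symm.pos hp'2 hΩ_bdd) hdiv (hf.mono_exponent (hP'2.trans hq2))
      hsob.2.1 (hsob.2.1.mono_exponent (hP'2.trans hP2)) hweak hae hlim_g hlim_Γ S
  refine ⟨⟨hu, hbound.trans_lt ENNReal.ofReal_lt_top⟩, hbound.trans (le_of_eq ?_)⟩
  rw [ENNReal.ofReal_mul hc.le, ENNReal.ofReal_toReal hf.2.ne]
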